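/- Let $d\in\mathbb N$ be fixed and let $(\mathbf X_1,Y_1),(\mathbf X_2,Y_2),\dots$ be i.i.d. copies of $(\mathbf X,Y)\sim P$ with $\mathbf X=(X_1,\dots,X_d)^T\in\mathbb R^d$ and $Y\in\mathbb R$. Fix $\mathbf x_0,\mathbf h\in\mathbb R^d$, not depending on $n$, and let $N_{\mathbf h}(\mathbf x_0)=\prod_{j=1}^d[x_{0j}-h_j,\,x_{0j}+h_j]$. Put $\mathcal V(\mathbf h)=P(\mathbf X\in N_{\mathbf h}(\mathbf x_0))$ and write $E^{\mathbf h}$, $\mathrm{Var}^{\mathbf h}$ for expectation and variance under the conditional distribution of $(\mathbf X,Y)$ given $\mathbf X\in N_{\mathbf h}(\mathbf x_0)$. Put $X_0\equiv 1$ and $X_{i0}\equiv 1$, and let $$\Sigma_{1\mathbf X}(\mathbf h)=\bigl(E^{\mathbf h}[X_jX_k]\bigr)_{0\le j,k\le d}.$$ Let $\widehat{\boldsymbol\beta}(\mathbf h)=(X_{\mathbf h}^TX_{\mathbf h})^{-1}X_{\mathbf h}^T\mathbf Y_{\mathbf h}$ be the local least-squares estimator based on the first $n$ observations, where $X_{\mathbf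 h}$ has the rows $(1,X_{i1},\dots,X_{id})$ and $\mathbf Y_{\mathbf h}$ the entries $Y_i$, for those $i\le n$ with $\mathbf X_i\in N_{\mathbf h}(\mathbf x_0)$ (with $\widehat{\boldsymbol\beta}(\mathbf h)=\mathbf 0$ when $X_{\mathbf h}^TX_{\mathbf h}$ is singular). Suppose that $\mathcal V(\mathbf h)>0$, that $0<\mathrm{Var}^{\mathbf h}(Y)<\infty$, and that $\Sigma_{1\mathbf X}(\mathbf h)$ is invertible. Then there is a unique minimizer $\boldsymbol\beta(\mathbf h)=(\beta_0,\dots,\beta_d)^T\in\mathbb R^{d+1}$ of $E^{\mathbf h}\bigl[Y-\sum_{j=0}^d\beta_jX_j\bigr]^2$; with $e=Y-\sum_{j=0}^d\beta_j(\mathbf h)X_j$, the entries of $$\Sigma_{\mathbf X\mathbf e}(\mathbf h)=\bigl(E^{\mathbf h}[e^2X_jX_k]\bigr)_{0\le j,k\le d}$$ are finite, the matrix $\mathcal V^{-1}(\mathbf h)\,\Sigma_{1\mathbf X}^{-1}(\mathbf h)\,\Sigma_{\mathbf X\mathbf e}(\mathbf h)\,\Sigma_{1\mathbf X}^{-1}(\mathbf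 h)$ is positive semidefinite, and, as $n\to\infty$, $$\sqrt n\,\bigl[\widehat{\boldsymbol\beta}(\mathbf h)-\boldsymbol\beta(\mathbf h)\bigr]\xrightarrow{\ \mathcal L\ }\mathcal N\Bigl(\mathbf 0,\ \mathcal V^{-1}(\mathbf h)\,\Sigma_{1\mathbf X}^{-1}(\mathbf h)\,\Sigma_{\mathbf X\mathbf e}(\mathbf h)\,\Sigma_{1\mathbf X}^{-1}(\mathbf h)\Bigr)$$ (a possibly degenerate normal distribution). -/

import Mathlib

open MeasureTheory ProbabilityTheory Filter

namespace LocalLinear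

variable {d : ℕ}

/-- The neighbourhood `N_h(x₀)`: the box of all `x` with `x₀ⱼ - hⱼ ≤ xⱼ ≤ x₀ⱼ + hⱼ` for every `j`. -/
def nbhd (x₀ h : Fin d → ℝ) : Set (Fin d → ℝ) :=
  {x | ∀ j, x j ∈ Set.Icc (x₀ j - h j) (x₀ j + h j)}

/-- The covariate vector with the constant coordinate `1` put in front (coordinate `0`). -/
def withOne (x : Fin d → ℝ) : Fin (d + 1) → ℝ := Fin.cons 1 x

/-- `V(h)`: the probability that `X` falls in the neighbourhood, where `(X, Y) ∼ P`. -/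
noncomputable def mass (P : Measure ((Fin d → ℝ) × ℝ)) (x₀ h : Fin d → ℝ) : ℝ :=
  P.real {p | p.1 ∈ nbhd x₀ h}

/-- `P^h`: the conditional law of `(X, Y)` given that `X` falls in the neighbourhood. -/
noncomputable def localLaw (P : Measure ((Fin d → ℝ) × ℝ)) (x₀ h : Fin d → ℝ) :
    Measure ((Fin d → ℝ) × ℝ) :=
  ProbabilityTheory.cond P {p | p.1 ∈ nbhd x₀ h}

/-- The residual `Y - (b₀ + b₁ X₁ + ⋯ + b_d X_d)` as a function of `(X, Y)`. -/
def residual (b : EuclideanSpace ℝ (Fin (d + 1))) (p : (Fin d → ℝ) × ℝ) : ℝ :=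
  p.2 - ∑ j, b j * withOne p.1 j

/-- `β` is a coefficient vector of a best local linear fit: it minimizes
`E^h [Y - (a + bᵀ X)]²` over all `a` and `b`. -/
def IsBestLocalFit (P : Measure ((Fin d → ℝ) × ℝ)) (x₀ h : Fin d → ℝ)
    (β : EuclideanSpace ℝ (Fin (d + 1))) : Prop :=
  ∀ b : EuclideanSpace ℝ (Fin (d + 1)),
    ∫ p, residual β p ^ 2 ∂(localLaw P x₀ h) ≤ ∫ p, residual b p ^ 2 ∂(localLaw P x₀ h)

/-- `Σ_{1X}(h) = (E^h [Xⱼ X_k])`, `0 ≤ j, k ≤ d`, with `X₀ = 1`. -/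
noncomputable def sigmaOneX (P : Measure ((Fin d → ℝ) × ℝ)) (x₀ h : Fin d → ℝ) :
    Matrix (Fin (d + 1)) (Fin (d + 1)) ℝ :=
  Matrix.of fun j k => ∫ p, withOne p.1 j * withOne p.1 k ∂(localLaw P x₀ h)

/-- `Σ_{Xe}(h) = (E^h [e² Xⱼ X_k])`, `0 ≤ j, k ≤ d`, with `X₀ = 1` and `e` the residual at `β`. -/
noncomputable def sigmaXe (P : Measure ((Fin d → ℝ) × ℝ)) (x₀ h : Fin d → ℝ)
    (β : EuclideanSpace ℝ (Fin (d + 1))) : Matrix (Fin (d + 1)) (Fin (d + 1)) ℝ :=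
  Matrix.of fun j k =>
    ∫ p, residual β p ^ 2 * withOne p.1 j * withOne p.1 k ∂(localLaw P x₀ h)

/-- The sandwich matrix `V(h)⁻¹ Σ_{1X}(h)⁻¹ Σ_{Xe}(h) Σ_{1X}(h)⁻¹`. -/
noncomputable def sandwich (P : Measure ((Fin d → ℝ) × ℝ)) (x₀ h : Fin d → ℝ)
    (β : EuclideanSpace ℝ (Fin (d + 1))) : Matrix (Fin (d + 1)) (Fin (d + 1)) ℝ :=
  (mass P x₀ h)⁻¹ • ((sigmaOneX P x₀ h)⁻¹ * sigmaXe P x₀ h β * (sigmaOneX P x₀ h)⁻¹)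

/-- The local design matrix: one row `(1, xᵢ)` for each observation `i` with `xᵢ` in the
neighbourhood. -/
def design {n : ℕ} (x₀ h : Fin d → ℝ) (x : Fin n → Fin d → ℝ) :
    Matrix {i : Fin n // x i ∈ nbhd x₀ h} (Fin (d + 1)) ℝ :=
  Matrix.of fun i => withOne (x i)

open scoped Classical in
/-- The local least squares estimator `(X_hᵀ X_h)⁻¹ X_hᵀ Y_h` of a sample of size `n`
(the zero vector when `X_hᵀ X_h` is singular). -/
noncomputable def estimator {n : ℕ} (x₀ h : Fin d → ℝ) (x : Fin n → Fin d → ℝ)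
    (y : Fin n → ℝ) : EuclideanSpace ℝ (Fin (d + 1)) :=
  WithLp.toLp 2 (Matrix.mulVec ((design x₀ h x).transpose * design x₀ h x)⁻¹
    (Matrix.mulVec (design x₀ h x).transpose fun i => y i))

end LocalLinear

/-! Let `A = V(h) Σ_{1X}(h)`, the expected contribution of one observation to the local Gram matrix,
and let `G_n` be the sum of these contributions over the sample. A vector `β` solving the normal
equations `E^h[e X_j] = 0` satisfies a Pythagoras identity (`integral_residual_sq`), and
invertibility of `Σ_{1X}(h)` makes it the only minimizer.

Writing local sums as sums of indicators over all `n` observations turns the random local sample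
size into ordinary i.i.d. sums. Whenever `G_n` is invertible, the error is exactly `G_n⁻¹ A ∑ ψ(X_i,
Y_i)`, where `ψ = A⁻¹ (1_N e X_j)_j` is the influence function (`estimator_sub_eq`). The `ψ(X_i,
Y_i)` are centred by the normal equations and have covariance `A⁻¹ (V Σ_{Xe}) A⁻¹`, the sandwich.
The strong law gives `n⁻¹ G_n → A` almost surely, the central limit theorem handles `n^{-1/2} ∑ ψ`,
and Slutsky combines them. Covariates are bounded on the box, so a second moment of `Y` suffices
throughout. -/

namespace LocalLinear

/-! ### Multivariate central limit theorem -/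

/-- **Multivariate central limit theorem** for centred square-integrable i.i.d. vectors. -/
theorem tendstoInDistribution_inv_sqrt_smul_sum {ι Ω : Type*} [Fintype ι] [DecidableEq ι]
    [MeasurableSpace Ω] {μ : Measure Ω} [IsProbabilityMeasure μ]
    {ξ : ℕ → Ω → EuclideanSpace ℝ ι} {S : Matrix ι ι ℝ}
    (hindep : iIndepFun ξ μ) (hident : ∀ i, IdentDistrib (ξ i) (ξ 0) μ μ)
    (hL2 : ∀ j, MemLp (fun ω => ξ 0 ω j) 2 μ) (hmean : ∀ j, ∫ ω, ξ 0 ω j ∂μ = 0)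
    (hS : S.PosSemidef) (hcov : ∀ j k, ∫ ω, ξ 0 ω j * ξ 0 ω k ∂μ = S j k) :
    TendstoInDistribution
      (fun (n : ℕ) ω => (√(n : ℝ))⁻¹ • ∑ i ∈ Finset.range n, ξ i ω)
      atTop id (fun _ => μ) (multivariateGaussian 0 S) where
  forall_aemeasurable n :=
    (Finset.aemeasurable_fun_sum _ fun i _ => (hident i).aemeasurable_fst).fun_const_smul (√(n : ℝ))⁻¹
  aemeasurable_limit := aemeasurable_id
  tendsto := by
    refine ProbabilityMeasure.tendsto_iff_tendsto_charFun.2 fun t => ?_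
    have hsum : ∀ v : EuclideanSpace ℝ ι, inner ℝ v t = ∑ j, t j * v j := fun v => by
      simp [PiLp.inner_apply]
    have hmem : MemLp (fun ω => inner ℝ (ξ 0 ω) t) 2 μ := by
      simp only [hsum]
      exact memLp_finsetSum _ fun j _ => (hL2 j).const_mul (t j)
    have hzero : ∫ ω, inner ℝ (ξ 0 ω) t ∂μ = 0 := by
      simp only [hsum]
      rw [integral_finsetSum _ fun j _ =>
        ((hL2 j).const_mul (t j)).integrable one_le_two]
      simp [integral_const_mul, hmean]
    have hvar : Var[fun ω => inner ℝ (ξ 0 ω) t; μ] = t.ofLp ⬝ᵥ S.mulVec t.ofLp := by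
      rw [variance_eq_integral hmem.aemeasurable, hzero]
      simp only [sub_zero, hsum, sq, Finset.sum_mul_sum]
      have hint : ∀ j k, Integrable (fun ω => t j * ξ 0 ω j * (t k * ξ 0 ω k)) μ := fun j k =>
        ((hL2 j).const_mul (t j)).integrable_mul ((hL2 k).const_mul (t k))
      rw [integral_finsetSum _ fun j _ => integrable_finsetSum _ fun k _ => hint j k]
      simp only [dotProduct, Matrix.mulVec, Finset.mul_sum]
      refine Finset.sum_congr rfl fun j _ => ?_
      rw [integral_finsetSum _ fun k _ => hint j k]
      refine Finset.sum_congr rfl fun k _ => ?_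
      rw [← hcov j k, ← integral_mul_const, ← integral_const_mul]
      congr 1 with ω
      ring
    -- Cramér–Wold: the characteristic function of a vector at `t` is that of its projection on `t`
    -- at frequency `1`, so the scalar theorem suffices.
    have hclt := tendstoInDistribution_inv_sqrt_mul_sum_sub (Y := id)
      (P' := gaussianReal 0 Var[fun ω => inner ℝ (ξ 0 ω) t; μ].toNNReal)
      (X := fun i ω => inner ℝ (ξ i ω) t) HasLaw.id hmem
      (hindep.comp (fun _ v => inner ℝ v t) fun _ => by fun_prop)
      (fun i => (hident i).comp (u := fun v => inner ℝ v t) (by fun_prop))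
    have hlim := ProbabilityMeasure.tendsto_iff_tendsto_charFun.1 hclt.tendsto 1
    have hnonneg : 0 ≤ t.ofLp ⬝ᵥ S.mulVec t.ofLp := hvar ▸ variance_nonneg _ _
    simp only [ProbabilityMeasure.coe_mk, Measure.map_id, charFun_gaussianReal, hzero, hvar,
      mul_zero, sub_zero, Real.coe_toNNReal _ hnonneg] at hlim
    simp only [ProbabilityMeasure.coe_mk, Measure.map_id, charFun_multivariateGaussian hS]
    convert hlim using 2 with n
    · rw [charFun_apply, charFun_apply_real, integral_map, integral_map]
      · congr 1 with ω
        simp [inner_smul_left, sum_inner]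
      · exact (Finset.aemeasurable_fun_sum _ fun i _ =>
          (hident i).aemeasurable_fst.inner_const).const_mul _
      · fun_prop
      · exact (Finset.aemeasurable_fun_sum _ fun i _ =>
          (hident i).aemeasurable_fst).fun_const_smul (√(n : ℝ))⁻¹
      · fun_prop
    · simp

/-! ### The local law and its moments -/

variable {d : ℕ} {P : Measure ((Fin d → ℝ) × ℝ)} {x₀ h : Fin d → ℝ}

lemma measurableSet_nbhd (x₀ h : Fin d → ℝ) :
    MeasurableSet {p : (Fin d → ℝ) × ℝ | p.1 ∈ nbhd x₀ h} := by
  have : nbhd x₀ h = Set.pi Set.univ fun j => Set.Icc (x₀ j - h j) (x₀ j + h j) := by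
    ext x; simp only [nbhd, Set.mem_ofPred_eq, Set.mem_univ_pi]
  rw [this]
  exact measurable_fst (MeasurableSet.univ_pi fun _ => measurableSet_Icc)

@[fun_prop]
lemma measurable_withOne (j : Fin (d + 1)) :
    Measurable fun p : (Fin d → ℝ) × ℝ => withOne p.1 j := by
  refine Fin.cases ?_ (fun i => ?_) j
  · simp only [withOne, Fin.cons_zero]; fun_prop
  · simp only [withOne, Fin.cons_succ]; fun_prop

@[fun_prop]
lemma measurable_residual (b : EuclideanSpace ℝ (Fin (d + 1))) :
    Measurable (residual b : (Fin d → ℝ) × ℝ → ℝ) := by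
  unfold residual; fun_prop

/-- The box is bounded; the summand `1` in the bound covers the constant coordinate. Hence
multiplying by a covariate costs no integrability under the local law. -/
lemma exists_abs_withOne_le (x₀ h : Fin d → ℝ) :
    ∃ C, ∀ x ∈ nbhd x₀ h, ∀ j, |withOne x j| ≤ C := by
  refine ⟨1 + ∑ j, (|x₀ j| + |h j|), fun x hx j => ?_⟩
  have hnonneg : ∀ j ∈ Finset.univ, 0 ≤ |x₀ j| + |h j| := fun j _ => by positivity
  refine Fin.cases ?_ (fun i => ?_) j
  · simpa [withOne] using Finset.sum_nonneg hnonneg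
  · have := Finset.single_le_sum hnonneg (Finset.mem_univ i)
    obtain ⟨h₁, h₂⟩ := hx i
    simp only [withOne, Fin.cons_succ]
    refine le_trans ?_ (this.trans (by linarith))
    rw [abs_le]
    constructor <;> linarith [le_abs_self (x₀ i), neg_abs_le (x₀ i), le_abs_self (h i)]

lemma isProbabilityMeasure_localLaw [IsProbabilityMeasure P] (hV : 0 < mass P x₀ h) :
    IsProbabilityMeasure (localLaw P x₀ h) :=
  cond_isProbabilityMeasure fun h0 => hV.ne' (by simp [mass, measureReal_def, h0])

lemma integral_localLaw (f : (Fin d → ℝ) × ℝ → ℝ) :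
    ∫ p, f p ∂(localLaw P x₀ h) =
      (mass P x₀ h)⁻¹ * ∫ p, {p | p.1 ∈ nbhd x₀ h}.indicator f p ∂P := by
  rw [localLaw, ProbabilityTheory.cond, integral_smul_measure,
    integral_indicator (measurableSet_nbhd x₀ h), ENNReal.toReal_inv, smul_eq_mul]
  rfl

lemma memLp_indicator_of_localLaw [IsProbabilityMeasure P] {q : ENNReal}
    {f : (Fin d → ℝ) × ℝ → ℝ} (hf : MemLp f q (localLaw P x₀ h)) :
    MemLp ({p | p.1 ∈ nbhd x₀ h}.indicator f) q P := by
  rw [memLp_indicator_iff_restrict (measurableSet_nbhd x₀ h)]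
  -- The normalizing factor of the conditional law is the inverse of a probability, hence at least
  -- `1`.
  have hle : P.restrict {p | p.1 ∈ nbhd x₀ h} ≤ (1 : ENNReal) • localLaw P x₀ h := by
    rw [one_smul, localLaw, ProbabilityTheory.cond]
    intro s
    rw [Measure.smul_apply, smul_eq_mul]
    exact le_mul_of_one_le_left' (ENNReal.one_le_inv.2 prob_le_one)
  exact hf.of_measure_le_smul ENNReal.one_ne_top hle

lemma ae_localLaw_mem : ∀ᵐ p ∂(localLaw P x₀ h), p.1 ∈ nbhd x₀ h :=
  ae_cond_mem (measurableSet_nbhd x₀ h)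

/-- Multiplying by a covariate preserves `L²` under the local law. -/
lemma memLp_withOne_mul {f : (Fin d → ℝ) × ℝ → ℝ} {q : ENNReal}
    (hf : MemLp f q (localLaw P x₀ h)) (j : Fin (d + 1)) :
    MemLp (fun p => withOne p.1 j * f p) q (localLaw P x₀ h) := by
  obtain ⟨C, hC⟩ := exists_abs_withOne_le x₀ h
  have hj : MemLp (fun p : (Fin d → ℝ) × ℝ => withOne p.1 j) ⊤ (localLaw P x₀ h) :=
    memLp_top_of_bound (measurable_withOne j).aestronglyMeasurable C (ae_localLaw_mem.mono fun p hp => by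
      simpa using hC p.1 hp j)
  exact hf.mul hj

lemma memLp_withOne [IsProbabilityMeasure P] (hV : 0 < mass P x₀ h) (q : ENNReal)
    (j : Fin (d + 1)) : MemLp (fun p => withOne p.1 j) q (localLaw P x₀ h) := by
  have := isProbabilityMeasure_localLaw hV
  simpa using memLp_withOne_mul (memLp_const (1 : ℝ)) j

/-- The extended variance is `⊤` outside `L²`, so its finiteness already supplies the second moment.
-/
lemma memLp_snd [IsProbabilityMeasure P] (hV : 0 < mass P x₀ h)
    (hvar : evariance Prod.snd (localLaw P x₀ h) < ⊤) :
    MemLp (fun p => p.2) 2 (localLaw P x₀ h) := by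
  have := isProbabilityMeasure_localLaw hV
  by_contra hcon
  exact hvar.ne (evariance_eq_top measurable_snd.aestronglyMeasurable hcon)

lemma memLp_residual [IsProbabilityMeasure P] (hV : 0 < mass P x₀ h)
    (hY : MemLp (fun p => p.2) 2 (localLaw P x₀ h)) (b : EuclideanSpace ℝ (Fin (d + 1))) :
    MemLp (residual b) 2 (localLaw P x₀ h) :=
  hY.sub (memLp_finsetSum _ fun j _ => (memLp_withOne hV 2 j).const_mul (b j))

/-! ### Population least squares and the normal equations -/

lemma memLp_linear [IsProbabilityMeasure P] (hV : 0 < mass P x₀ h) (v : Fin (d + 1) → ℝ) :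
    MemLp (fun p => ∑ j, v j * withOne p.1 j) 2 (localLaw P x₀ h) :=
  memLp_finsetSum _ fun j _ => (memLp_withOne hV 2 j).const_mul (v j)

lemma integral_mul_linear [IsProbabilityMeasure P] (hV : 0 < mass P x₀ h)
    {f : (Fin d → ℝ) × ℝ → ℝ} (hf : MemLp f 2 (localLaw P x₀ h)) (v : Fin (d + 1) → ℝ) :
    ∫ p, f p * ∑ j, v j * withOne p.1 j ∂(localLaw P x₀ h) =
      ∑ j, v j * ∫ p, f p * withOne p.1 j ∂(localLaw P x₀ h) := by
  simp only [Finset.mul_sum, mul_left_comm (f _)]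
  have hint : ∀ j, Integrable (fun p => f p * withOne p.1 j) (localLaw P x₀ h) := fun j =>
    hf.integrable_mul (memLp_withOne hV 2 j)
  rw [integral_finsetSum _ fun j _ => (hint j).const_mul (v j)]
  simp [integral_const_mul]

lemma integral_withOne_mul_linear [IsProbabilityMeasure P] (hV : 0 < mass P x₀ h)
    (v : Fin (d + 1) → ℝ) (j : Fin (d + 1)) :
    ∫ p, withOne p.1 j * ∑ k, v k * withOne p.1 k ∂(localLaw P x₀ h) =
      (sigmaOneX P x₀ h).mulVec v j := by
  rw [integral_mul_linear hV (memLp_withOne hV 2 j)]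
  simp [Matrix.mulVec, dotProduct, sigmaOneX, mul_comm]

lemma isSymm_sigmaOneX : (sigmaOneX P x₀ h).IsSymm := by
  ext j k
  simp [sigmaOneX, mul_comm]

/-- A linear combination of covariates that vanishes in mean square is trivial. -/
lemma eq_zero_of_integral_linear_sq_eq_zero [IsProbabilityMeasure P] (hV : 0 < mass P x₀ h)
    (hinv : IsUnit (sigmaOneX P x₀ h)) {v : Fin (d + 1) → ℝ}
    (hv : ∫ p, (∑ j, v j * withOne p.1 j) ^ 2 ∂(localLaw P x₀ h) = 0) : v = 0 := by
  rw [integral_eq_zero_iff_of_nonneg (fun p => sq_nonneg _)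
    (memLp_linear hV v).integrable_sq] at hv
  -- The linear form vanishes almost everywhere, hence so does its inner product with each
  -- covariate; these inner products are the entries of `Σ_{1X} v`.
  refine Matrix.mulVec_injective_of_isUnit hinv ?_
  ext j
  rw [← integral_withOne_mul_linear hV, Matrix.mulVec_zero, Pi.zero_apply]
  refine integral_eq_zero_of_ae (hv.mono fun p hp => ?_)
  have : ∑ j, v j * withOne p.1 j = 0 := by simpa using hp
  simp [this]

lemma residual_eq_add (β b : EuclideanSpace ℝ (Fin (d + 1))) (p : (Fin d → ℝ) × ℝ) :
    residual b p = residual β p + ∑ j, (β - b) j * withOne p.1 j := by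
  simp [residual, sub_mul, Finset.sum_sub_distrib]

/-- Pythagoras for the local least squares criterion at a solution of the normal equations. -/
lemma integral_residual_sq [IsProbabilityMeasure P] (hV : 0 < mass P x₀ h)
    (hY : MemLp (fun p => p.2) 2 (localLaw P x₀ h)) {β : EuclideanSpace ℝ (Fin (d + 1))}
    (hβ : ∀ j, ∫ p, residual β p * withOne p.1 j ∂(localLaw P x₀ h) = 0)
    (b : EuclideanSpace ℝ (Fin (d + 1))) :
    ∫ p, residual b p ^ 2 ∂(localLaw P x₀ h) = ∫ p, residual β p ^ 2 ∂(localLaw P x₀ h) +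
      ∫ p, (∑ j, (β - b) j * withOne p.1 j) ^ 2 ∂(localLaw P x₀ h) := by
  have hr := memLp_residual hV hY β
  have hl := memLp_linear (P := P) hV (β - b).ofLp
  have hcross := integral_mul_linear hV hr (β - b).ofLp
  -- The residual at `β` is orthogonal to every linear form, which removes the cross term.
  simp only [hβ, mul_zero, Finset.sum_const_zero] at hcross
  have hi : Integrable (fun p => residual β p * ∑ j, (β - b) j * withOne p.1 j)
      (localLaw P x₀ h) := hr.integrable_mul hl
  have hexp : ∀ p, residual b p ^ 2 = residual β p ^ 2 + (∑ j, (β - b) j * withOne p.1 j) ^ 2 +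
      2 * (residual β p * ∑ j, (β - b) j * withOne p.1 j) := fun p => by
    rw [residual_eq_add β b p]
    ring
  have hs : Integrable (fun p => residual β p ^ 2 + (∑ j, (β - b) j * withOne p.1 j) ^ 2)
      (localLaw P x₀ h) := hr.integrable_sq.add hl.integrable_sq
  simp only [hexp]
  rw [integral_add hs (hi.const_mul 2),
    integral_add hr.integrable_sq hl.integrable_sq, integral_const_mul, hcross, mul_zero, add_zero]

lemma exists_normal_equations [IsProbabilityMeasure P] (hV : 0 < mass P x₀ h)
    (hY : MemLp (fun p => p.2) 2 (localLaw P x₀ h)) (hinv : IsUnit (sigmaOneX P x₀ h)) :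
    ∃ β : EuclideanSpace ℝ (Fin (d + 1)),
      ∀ j, ∫ p, residual β p * withOne p.1 j ∂(localLaw P x₀ h) = 0 := by
  set c : Fin (d + 1) → ℝ := fun j => ∫ p, withOne p.1 j * p.2 ∂(localLaw P x₀ h)
  refine ⟨WithLp.toLp 2 ((sigmaOneX P x₀ h)⁻¹.mulVec c), fun j => ?_⟩
  have hj := memLp_withOne hV 2 j
  have hsplit := integral_withOne_mul_linear hV ((sigmaOneX P x₀ h)⁻¹.mulVec c) j
  rw [Matrix.mulVec_mulVec, Matrix.mul_nonsing_inv _ ((Matrix.isUnit_iff_isUnit_det _).1 hinv),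
    Matrix.one_mulVec] at hsplit
  have h₁ : Integrable (fun p => withOne p.1 j * p.2) (localLaw P x₀ h) := hj.integrable_mul hY
  have h₂ : Integrable (fun p => withOne p.1 j *
      ∑ k, (sigmaOneX P x₀ h)⁻¹.mulVec c k * withOne p.1 k) (localLaw P x₀ h) :=
    hj.integrable_mul (memLp_linear hV _)
  simp only [residual, mul_comm _ (withOne _ j), mul_sub]
  rw [integral_sub h₁ h₂, hsplit, sub_self]

/-- By Pythagoras the excess risk of `b` is the mean square of the linear form with coefficients `β
- b`: it is nonnegative, and zero only for `b = β`. -/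
lemma isBestLocalFit_iff_eq [IsProbabilityMeasure P] (hV : 0 < mass P x₀ h)
    (hY : MemLp (fun p => p.2) 2 (localLaw P x₀ h)) (hinv : IsUnit (sigmaOneX P x₀ h))
    {β : EuclideanSpace ℝ (Fin (d + 1))}
    (hβ : ∀ j, ∫ p, residual β p * withOne p.1 j ∂(localLaw P x₀ h) = 0)
    (b : EuclideanSpace ℝ (Fin (d + 1))) : IsBestLocalFit P x₀ h b ↔ b = β := by
  constructor
  · intro hb
    have hle := hb β
    rw [integral_residual_sq hV hY hβ b] at hle
    have h0 := eq_zero_of_integral_linear_sq_eq_zero hV hinv (v := (β - b).ofLp)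
      (le_antisymm (by linarith) (integral_nonneg fun p => sq_nonneg _))
    exact (sub_eq_zero.1 ((WithLp.ofLp_injective 2) h0)).symm
  · rintro rfl b'
    rw [integral_residual_sq hV hY hβ b']
    exact le_add_of_nonneg_right (integral_nonneg fun p => sq_nonneg _)

/-! ### Scores, influence function and sandwich covariance -/

lemma integral_indicator_nbhd (hV : 0 < mass P x₀ h) (f : (Fin d → ℝ) × ℝ → ℝ) :
    ∫ p, {p | p.1 ∈ nbhd x₀ h}.indicator f p ∂P =
      mass P x₀ h * ∫ p, f p ∂(localLaw P x₀ h) := by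
  rw [integral_localLaw, mul_inv_cancel_left₀ hV.ne']

/-- The integrand is the product of the `L²` functions `e X_j` and `e X_k`; no fourth moment is
involved. -/
lemma integrable_residual_sq_mul [IsProbabilityMeasure P] (hV : 0 < mass P x₀ h)
    (hY : MemLp (fun p => p.2) 2 (localLaw P x₀ h)) (β : EuclideanSpace ℝ (Fin (d + 1)))
    (j k : Fin (d + 1)) :
    Integrable (fun p => residual β p ^ 2 * withOne p.1 j * withOne p.1 k)
      (localLaw P x₀ h) := by
  have hr := memLp_residual hV hY β
  refine ((memLp_withOne_mul hr j).integrable_mul (memLp_withOne_mul hr k)).congr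
    (ae_of_all _ fun p => ?_)
  simp only [Pi.mul_apply]
  ring

/-- The product of the residual at `β` with the linear form `v` in the covariates, localized to the
neighbourhood. -/
noncomputable def score (x₀ h : Fin d → ℝ) (β : EuclideanSpace ℝ (Fin (d + 1)))
    (v : Fin (d + 1) → ℝ) : (Fin d → ℝ) × ℝ → ℝ :=
  {p | p.1 ∈ nbhd x₀ h}.indicator fun p => residual β p * ∑ j, v j * withOne p.1 j

@[fun_prop]
lemma measurable_score (x₀ h : Fin d → ℝ) (β : EuclideanSpace ℝ (Fin (d + 1)))
    (v : Fin (d + 1) → ℝ) : Measurable (score x₀ h β v) :=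
  Measurable.indicator (by fun_prop) (measurableSet_nbhd x₀ h)

lemma score_eq_sum (β : EuclideanSpace ℝ (Fin (d + 1))) (v : Fin (d + 1) → ℝ)
    (p : (Fin d → ℝ) × ℝ) :
    score x₀ h β v p = ∑ j, v j * {p : (Fin d → ℝ) × ℝ | p.1 ∈ nbhd x₀ h}.indicator
      (fun p => residual β p * withOne p.1 j) p := by
  by_cases hp : p ∈ {p : (Fin d → ℝ) × ℝ | p.1 ∈ nbhd x₀ h}
  · simp only [score, Set.indicator_of_mem hp, Finset.mul_sum, mul_left_comm]
  · simp [score, Set.indicator_of_notMem hp]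

lemma memLp_score [IsProbabilityMeasure P] (hV : 0 < mass P x₀ h)
    (hY : MemLp (fun p => p.2) 2 (localLaw P x₀ h)) (β : EuclideanSpace ℝ (Fin (d + 1)))
    (v : Fin (d + 1) → ℝ) : MemLp (score x₀ h β v) 2 P := by
  refine memLp_indicator_of_localLaw ?_
  refine (memLp_finsetSum Finset.univ fun j _ =>
    (memLp_withOne_mul (memLp_residual hV hY β) j).const_mul (v j)).ae_eq (ae_of_all _ fun p => ?_)
  simp only [Finset.mul_sum]
  exact Finset.sum_congr rfl fun j _ => by ring

lemma integral_score [IsProbabilityMeasure P] (hV : 0 < mass P x₀ h)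
    (hY : MemLp (fun p => p.2) 2 (localLaw P x₀ h)) {β : EuclideanSpace ℝ (Fin (d + 1))}
    (hβ : ∀ j, ∫ p, residual β p * withOne p.1 j ∂(localLaw P x₀ h) = 0)
    (v : Fin (d + 1) → ℝ) : ∫ p, score x₀ h β v p ∂P = 0 := by
  rw [score, integral_indicator_nbhd hV, integral_mul_linear hV (memLp_residual hV hY β)]
  simp [hβ]

lemma integral_score_mul_score [IsProbabilityMeasure P] (hV : 0 < mass P x₀ h)
    (hY : MemLp (fun p => p.2) 2 (localLaw P x₀ h)) (β : EuclideanSpace ℝ (Fin (d + 1)))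
    (v w : Fin (d + 1) → ℝ) :
    ∫ p, score x₀ h β v p * score x₀ h β w p ∂P =
      mass P x₀ h * (v ⬝ᵥ (sigmaXe P x₀ h β).mulVec w) := by
  simp only [score, ← Set.indicator_mul]
  rw [integral_indicator_nbhd hV]
  congr 1
  have hexp : ∀ p : (Fin d → ℝ) × ℝ, (residual β p * ∑ j, v j * withOne p.1 j) *
      (residual β p * ∑ j, w j * withOne p.1 j) =
      ∑ j, ∑ k, v j * (residual β p ^ 2 * withOne p.1 j * withOne p.1 k * w k) := fun p => by
    rw [mul_mul_mul_comm, Finset.sum_mul_sum, Finset.mul_sum]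
    refine Finset.sum_congr rfl fun j _ => ?_
    rw [Finset.mul_sum]
    exact Finset.sum_congr rfl fun k _ => by ring
  have hint := integrable_residual_sq_mul hV hY β
  simp only [hexp]
  rw [integral_finsetSum _ fun j _ => integrable_finsetSum _ fun k _ =>
    ((hint j k).mul_const (w k)).const_mul (v j)]
  simp only [dotProduct, Matrix.mulVec, Finset.mul_sum]
  refine Finset.sum_congr rfl fun j _ => ?_
  rw [integral_finsetSum _ fun k _ => ((hint j k).mul_const (w k)).const_mul (v j)]
  refine Finset.sum_congr rfl fun k _ => ?_
  rw [integral_const_mul, integral_mul_const]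
  rfl

/-- The influence function of the local least squares estimator at `β`. -/
noncomputable def influence (P : Measure ((Fin d → ℝ) × ℝ)) (x₀ h : Fin d → ℝ)
    (β : EuclideanSpace ℝ (Fin (d + 1))) (p : (Fin d → ℝ) × ℝ) :
    EuclideanSpace ℝ (Fin (d + 1)) :=
  WithLp.toLp 2 fun j => score x₀ h β ((mass P x₀ h)⁻¹ • (sigmaOneX P x₀ h)⁻¹ j) p

@[fun_prop]
lemma measurable_influence (β : EuclideanSpace ℝ (Fin (d + 1))) :
    Measurable (influence P x₀ h β) :=
  (WithLp.measurable_toLp 2 _).comp (measurable_pi_lambda _ fun _ => by fun_prop)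

/-- Each influence factor carries `V⁻¹`; passing from `P` to the local law gives back one `V`,
leaving the single `V⁻¹` of the sandwich. -/
lemma integral_influence_mul_influence [IsProbabilityMeasure P] (hV : 0 < mass P x₀ h)
    (hY : MemLp (fun p => p.2) 2 (localLaw P x₀ h)) (β : EuclideanSpace ℝ (Fin (d + 1)))
    (j k : Fin (d + 1)) :
    ∫ p, influence P x₀ h β p j * influence P x₀ h β p k ∂P = sandwich P x₀ h β j k := by
  -- Symmetry of `Σ_{1X}⁻¹` turns the row used in `influence` into the column needed for the
  -- right-hand factor.
  have hsymm : (sigmaOneX P x₀ h)⁻¹ k = (sigmaOneX P x₀ h)⁻¹.col k := by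
    ext i
    have : ((sigmaOneX P x₀ h)⁻¹).transpose = (sigmaOneX P x₀ h)⁻¹ := by
      rw [Matrix.transpose_nonsing_inv, isSymm_sigmaOneX.eq]
    exact (congrFun (congrFun this i) k)
  simp only [influence]
  rw [integral_score_mul_score hV hY, hsymm, sandwich, Matrix.smul_apply, Matrix.mul_assoc,
    Matrix.mulVec_smul, smul_dotProduct, dotProduct_smul, smul_eq_mul, smul_eq_mul, smul_eq_mul,
    mul_inv_cancel_left₀ hV.ne']
  rfl

/-- As the second-moment matrix of the influence function, it has quadratic form `E[(∑ t_j ψ_j)²]`.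
-/
lemma posSemidef_sandwich [IsProbabilityMeasure P] (hV : 0 < mass P x₀ h)
    (hY : MemLp (fun p => p.2) 2 (localLaw P x₀ h)) (β : EuclideanSpace ℝ (Fin (d + 1))) :
    (sandwich P x₀ h β).PosSemidef := by
  have hmem : ∀ j, MemLp (fun p => influence P x₀ h β p j) 2 P := fun j => memLp_score hV hY β _
  have hcov := integral_influence_mul_influence hV hY β
  refine Matrix.PosSemidef.of_dotProduct_mulVec_nonneg ?_ fun t => ?_
  · ext j k
    rw [Matrix.conjTranspose_apply, star_trivial, ← hcov, ← hcov]
    simp only [mul_comm]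
  · have hint : ∀ j k, Integrable
        (fun p => t j * (influence P x₀ h β p j * influence P x₀ h β p k * t k)) P := fun j k =>
      (((hmem j).integrable_mul (hmem k)).mul_const (t k)).const_mul (t j)
    have : star t ⬝ᵥ (sandwich P x₀ h β).mulVec t =
        ∫ p, (∑ j, t j * influence P x₀ h β p j) ^ 2 ∂P := by
      have hexp : ∀ p, (∑ j, t j * influence P x₀ h β p j) ^ 2 =
          ∑ j, ∑ k, t j * (influence P x₀ h β p j * influence P x₀ h β p k * t k) := fun p => by
        rw [sq, Finset.sum_mul_sum]
        exact Finset.sum_congr rfl fun j _ => Finset.sum_congr rfl fun k _ => by ring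
      simp only [hexp]
      rw [integral_finsetSum _ fun j _ => integrable_finsetSum _ fun k _ => hint j k]
      simp only [dotProduct, Matrix.mulVec, Finset.mul_sum, star_trivial]
      refine Finset.sum_congr rfl fun j _ => ?_
      rw [integral_finsetSum _ fun k _ => hint j k]
      refine Finset.sum_congr rfl fun k _ => ?_
      rw [integral_const_mul, integral_mul_const, hcov]
    rw [this]
    exact integral_nonneg fun p => sq_nonneg _

/-! ### Sample normal equations -/

/-- The contribution of one observation to the local Gram matrix. -/
noncomputable def gramTerm (x₀ h : Fin d → ℝ) (p : (Fin d → ℝ) × ℝ) :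
    Matrix (Fin (d + 1)) (Fin (d + 1)) ℝ :=
  Matrix.of fun j k => {p : (Fin d → ℝ) × ℝ | p.1 ∈ nbhd x₀ h}.indicator
    (fun p => withOne p.1 j * withOne p.1 k) p

/-- The contribution of one observation to the right-hand side of the normal equations. -/
noncomputable def crossTerm (x₀ h : Fin d → ℝ) (p : (Fin d → ℝ) × ℝ) : Fin (d + 1) → ℝ :=
  fun j => {p : (Fin d → ℝ) × ℝ | p.1 ∈ nbhd x₀ h}.indicator (fun p => withOne p.1 j * p.2) p

@[fun_prop]
lemma measurable_gramTerm (x₀ h : Fin d → ℝ) (j k : Fin (d + 1)) :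
    Measurable fun p => gramTerm x₀ h p j k :=
  Measurable.indicator (by fun_prop) (measurableSet_nbhd x₀ h)

@[fun_prop]
lemma measurable_crossTerm (x₀ h : Fin d → ℝ) (j : Fin (d + 1)) :
    Measurable fun p => crossTerm x₀ h p j :=
  Measurable.indicator (by fun_prop) (measurableSet_nbhd x₀ h)

lemma integrable_gramTerm [IsProbabilityMeasure P] (hV : 0 < mass P x₀ h) (j k : Fin (d + 1)) :
    Integrable (fun p => gramTerm x₀ h p j k) P :=
  memLp_one_iff_integrable.1 <| memLp_indicator_of_localLaw <|
    memLp_withOne_mul (memLp_withOne hV 1 k) j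

lemma integral_gramTerm (hV : 0 < mass P x₀ h) (j k : Fin (d + 1)) :
    ∫ p, gramTerm x₀ h p j k ∂P = (mass P x₀ h • sigmaOneX P x₀ h) j k :=
  integral_indicator_nbhd hV _

/-- The influence function rescaled by the expected Gram matrix is the local normal equation. -/
lemma mulVec_influence [IsProbabilityMeasure P] (hV : 0 < mass P x₀ h)
    (hinv : IsUnit (sigmaOneX P x₀ h)) (β : EuclideanSpace ℝ (Fin (d + 1)))
    (p : (Fin d → ℝ) × ℝ) :
    (mass P x₀ h • sigmaOneX P x₀ h).mulVec (influence P x₀ h β p).ofLp =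
      crossTerm x₀ h p - (gramTerm x₀ h p).mulVec β.ofLp := by
  have hinf : (influence P x₀ h β p).ofLp = ((mass P x₀ h)⁻¹ • (sigmaOneX P x₀ h)⁻¹).mulVec
      (crossTerm x₀ h p - (gramTerm x₀ h p).mulVec β.ofLp) := by
    ext j
    simp only [influence, score_eq_sum, Matrix.mulVec, dotProduct]
    refine Finset.sum_congr rfl fun k _ => ?_
    congr 1
    by_cases hp : p ∈ {p : (Fin d → ℝ) × ℝ | p.1 ∈ nbhd x₀ h}
    · simp only [crossTerm, gramTerm, Set.indicator_of_mem hp, Matrix.mulVec, dotProduct,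
        Pi.sub_apply, Matrix.of_apply, residual, sub_mul, Finset.sum_mul]
      congr 1
      · ring
      · exact Finset.sum_congr rfl fun i _ => by ring
    · simp [crossTerm, gramTerm, Set.indicator_of_notMem hp, Matrix.mulVec, dotProduct]
  rw [hinf, Matrix.mulVec_mulVec, Matrix.smul_mul, Matrix.mul_smul, smul_smul,
    mul_inv_cancel₀ hV.ne', one_smul,
    Matrix.mul_nonsing_inv _ ((Matrix.isUnit_iff_isUnit_det _).1 hinv), Matrix.one_mulVec]

/-- The estimator in terms of sums over the whole sample. -/
lemma estimator_eq (x₀ h : Fin d → ℝ) (x : ℕ → Fin d → ℝ) (y : ℕ → ℝ) (n : ℕ) :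
    estimator x₀ h (fun i : Fin n => x i) (fun i : Fin n => y i) =
      WithLp.toLp 2 ((∑ i ∈ Finset.range n, gramTerm x₀ h (x i, y i))⁻¹.mulVec
        (∑ i ∈ Finset.range n, crossTerm x₀ h (x i, y i))) := by
  classical
  -- Indicators replace the sum over the data-dependent set of local observations by one over a
  -- fixed range.
  have hsum : ∀ g : ((Fin d → ℝ) × ℝ) → ℝ,
      ∑ i : {i : Fin n // x i ∈ nbhd x₀ h}, g (x i, y i) =
      ∑ i ∈ Finset.range n, {p : (Fin d → ℝ) × ℝ | p.1 ∈ nbhd x₀ h}.indicator g (x i, y i) := by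
    intro g
    rw [← Fin.sum_univ_eq_sum_range
      (fun i => {p : (Fin d → ℝ) × ℝ | p.1 ∈ nbhd x₀ h}.indicator g (x i, y i))]
    simp only [Set.indicator_apply, Set.mem_ofPred_eq]
    rw [← Finset.sum_filter]
    exact (Finset.sum_subtype _ (by simp) fun i : Fin n => g (x i, y i)).symm
  rw [estimator]
  congr 2
  · congr 1
    ext j k
    rw [Matrix.sum_apply]
    simp only [gramTerm, Matrix.of_apply, ← hsum]
    simp only [Matrix.mul_apply, Matrix.transpose_apply, design, Matrix.of_apply]
  · ext j
    simp only [Finset.sum_apply, crossTerm, ← hsum]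
    simp only [Matrix.mulVec, dotProduct, Matrix.transpose_apply, design, Matrix.of_apply]

/-- Summing `mulVec_influence` gives `A ∑ ψ = c_n - G_n β`, with `c_n` the summed cross terms;
applying `G_n⁻¹` yields the error with no remainder. -/
lemma estimator_sub_eq [IsProbabilityMeasure P] (hV : 0 < mass P x₀ h)
    (hinv : IsUnit (sigmaOneX P x₀ h)) (β : EuclideanSpace ℝ (Fin (d + 1)))
    (x : ℕ → Fin d → ℝ) (y : ℕ → ℝ) {n : ℕ}
    (hG : IsUnit (∑ i ∈ Finset.range n, gramTerm x₀ h (x i, y i))) :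
    estimator x₀ h (fun i : Fin n => x i) (fun i : Fin n => y i) - β =
      WithLp.toLp 2 (((∑ i ∈ Finset.range n, gramTerm x₀ h (x i, y i))⁻¹ *
        (mass P x₀ h • sigmaOneX P x₀ h)).mulVec
          (∑ i ∈ Finset.range n, influence P x₀ h β (x i, y i)).ofLp) := by
  have hsum : (mass P x₀ h • sigmaOneX P x₀ h).mulVec
      (∑ i ∈ Finset.range n, influence P x₀ h β (x i, y i)).ofLp =
      ∑ i ∈ Finset.range n, crossTerm x₀ h (x i, y i) -
        (∑ i ∈ Finset.range n, gramTerm x₀ h (x i, y i)).mulVec β.ofLp := by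
    rw [WithLp.ofLp_sum, Matrix.mulVec_sum, Matrix.sum_mulVec, ← Finset.sum_sub_distrib]
    exact Finset.sum_congr rfl fun i _ => mulVec_influence hV hinv β _
  rw [estimator_eq, ← Matrix.mulVec_mulVec, hsum, Matrix.mulVec_sub, Matrix.mulVec_mulVec,
    Matrix.nonsing_inv_mul _ ((Matrix.isUnit_iff_isUnit_det _).1 hG), Matrix.one_mulVec]
  rfl

/-! ### Regularity of matrix inversion -/

lemma continuousAt_inv_of_isUnit {m : Type*} [Fintype m] [DecidableEq m] {A : Matrix m m ℝ}
    (hA : IsUnit A) : ContinuousAt Inv.inv A := by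
  refine continuousAt_matrix_inv A ?_
  rw [Ring.inverse_eq_inv']
  exact continuousAt_inv₀ ((Matrix.isUnit_iff_isUnit_det A).1 hA).ne_zero

lemma aemeasurable_inv_apply {m Ω : Type*} [Fintype m] [DecidableEq m] [MeasurableSpace Ω]
    {μ : Measure Ω} {A : Ω → Matrix m m ℝ} (hA : ∀ j k, AEMeasurable (fun ω => A ω j k) μ)
    (j k : m) : AEMeasurable (fun ω => (A ω)⁻¹ j k) μ := by
  have hA' : AEMeasurable (fun ω j k => A ω j k) μ :=
    aemeasurable_pi_lambda _ fun j => aemeasurable_pi_lambda _ fun k => hA j k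
  have hdet : Continuous fun B : m → m → ℝ => (Matrix.of B).det :=
    Continuous.matrix_det continuous_id
  have hadj : Continuous fun B : m → m → ℝ => (Matrix.of B).adjugate j k :=
    (Continuous.matrix_adjugate continuous_id).matrix_elem j k
  -- This formula also holds at singular matrices, where both sides are `0`, so measurability needs
  -- no case split.
  have heq : ∀ ω, (A ω)⁻¹ j k =
      (Matrix.of fun j k => A ω j k).det⁻¹ * (Matrix.of fun j k => A ω j k).adjugate j k := by
    intro ω
    rw [Matrix.inv_def, Ring.inverse_eq_inv']
    rfl
  simp only [heq]
  exact (hdet.measurable.comp_aemeasurable hA').inv.mul (hadj.measurable.comp_aemeasurable hA')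

/-! ### Limit theorems for the sample -/

section Sample

variable {Ω : Type*} [MeasurableSpace Ω] {μ : Measure Ω} {X : ℕ → Ω → Fin d → ℝ} {Y : ℕ → Ω → ℝ}

lemma aemeasurable_sum_gramTerm (hlaw : ∀ i, HasLaw (fun ω => (X i ω, Y i ω)) P μ)
    (x₀ h : Fin d → ℝ) (n : ℕ) (j k : Fin (d + 1)) :
    AEMeasurable (fun ω => (∑ i ∈ Finset.range n, gramTerm x₀ h (X i ω, Y i ω)) j k) μ := by
  simp only [Matrix.sum_apply]
  exact Finset.aemeasurable_fun_sum _ fun i _ =>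
    (measurable_gramTerm x₀ h j k).comp_aemeasurable (hlaw i).aemeasurable

lemma aemeasurable_estimator (hlaw : ∀ i, HasLaw (fun ω => (X i ω, Y i ω)) P μ)
    (x₀ h : Fin d → ℝ) (n : ℕ) :
    AEMeasurable (fun ω => estimator x₀ h (fun i : Fin n => X i ω) (fun i : Fin n => Y i ω)) μ := by
  simp only [fun ω => estimator_eq x₀ h (X · ω) (Y · ω) n]
  refine (WithLp.measurable_toLp 2 _).comp_aemeasurable (aemeasurable_pi_lambda _ fun j => ?_)
  simp only [Matrix.mulVec, dotProduct, Finset.sum_apply]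
  refine Finset.aemeasurable_fun_sum _ fun k _ => AEMeasurable.mul ?_ ?_
  · exact aemeasurable_inv_apply (aemeasurable_sum_gramTerm hlaw x₀ h n) j k
  · exact Finset.aemeasurable_fun_sum _ fun i _ =>
      (measurable_crossTerm x₀ h k).comp_aemeasurable (hlaw i).aemeasurable

lemma ae_tendsto_gram [IsProbabilityMeasure P]
    (hlaw : ∀ i, HasLaw (fun ω => (X i ω, Y i ω)) P μ)
    (hindep : iIndepFun (fun i ω => (X i ω, Y i ω)) μ) (hV : 0 < mass P x₀ h) :
    ∀ᵐ ω ∂μ, Tendsto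
      (fun n : ℕ => (n : ℝ)⁻¹ • ∑ i ∈ Finset.range n, gramTerm x₀ h (X i ω, Y i ω)) atTop
      (nhds (mass P x₀ h • sigmaOneX P x₀ h)) := by
  have hentry : ∀ j k, ∀ᵐ ω ∂μ, Tendsto
      (fun n : ℕ => (n : ℝ)⁻¹ • ∑ i ∈ Finset.range n, gramTerm x₀ h (X i ω, Y i ω) j k) atTop
      (nhds ((mass P x₀ h • sigmaOneX P x₀ h) j k)) := fun j k => by
    have hmeas := measurable_gramTerm x₀ h j k
    have hid : ∀ i, IdentDistrib (fun ω => gramTerm x₀ h (X i ω, Y i ω) j k)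
        (fun ω => gramTerm x₀ h (X 0 ω, Y 0 ω) j k) μ μ := fun i =>
      ((hlaw i).identDistrib (hlaw 0)).comp hmeas
    have hmean := (hlaw 0).integral_comp hmeas.aestronglyMeasurable
    rw [integral_gramTerm hV] at hmean
    rw [← hmean]
    refine strong_law_ae (fun i ω => gramTerm x₀ h (X i ω, Y i ω) j k) ?_
      (fun i k hik => (hindep.indepFun hik).comp hmeas hmeas) hid
    exact (((hlaw 0).map_eq ▸ integrable_gramTerm hV j k :
      Integrable _ (μ.map fun ω => (X 0 ω, Y 0 ω))).comp_aemeasurable (hlaw 0).aemeasurable)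
  filter_upwards [ae_all_iff.2 fun j => ae_all_iff.2 fun k => hentry j k] with ω hω
  refine tendsto_pi_nhds.2 fun j => tendsto_pi_nhds.2 fun k => ?_
  simpa only [Matrix.smul_apply, Matrix.sum_apply] using hω j k

lemma tendstoInDistribution_influence [IsProbabilityMeasure P] [IsProbabilityMeasure μ]
    (hlaw : ∀ i, HasLaw (fun ω => (X i ω, Y i ω)) P μ)
    (hindep : iIndepFun (fun i ω => (X i ω, Y i ω)) μ) (hV : 0 < mass P x₀ h)
    (hY : MemLp (fun p => p.2) 2 (localLaw P x₀ h)) {β : EuclideanSpace ℝ (Fin (d + 1))}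
    (hβ : ∀ j, ∫ p, residual β p * withOne p.1 j ∂(localLaw P x₀ h) = 0) :
    TendstoInDistribution
      (fun (n : ℕ) ω => (√(n : ℝ))⁻¹ • ∑ i ∈ Finset.range n, influence P x₀ h β (X i ω, Y i ω))
      atTop id (fun _ => μ) (multivariateGaussian 0 (sandwich P x₀ h β)) := by
  have hmeas : ∀ j, Measurable fun p => influence P x₀ h β p j := fun j => measurable_score x₀ h β _
  refine tendstoInDistribution_inv_sqrt_smul_sum
    (hindep.comp (fun _ => influence P x₀ h β) fun _ => measurable_influence β)
    (fun i => ((hlaw i).identDistrib (hlaw 0)).comp (measurable_influence β)) (fun j => ?_)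
    (fun j => ?_) (posSemidef_sandwich hV hY β) fun j k => ?_
  · exact (((hlaw 0).map_eq ▸ memLp_score hV hY β _ :
      MemLp (fun p => influence P x₀ h β p j) 2 (μ.map fun ω => (X 0 ω, Y 0 ω))).comp_of_map
        (hlaw 0).aemeasurable)
  · exact ((hlaw 0).integral_comp (hmeas j).aestronglyMeasurable).trans (integral_score hV hY hβ _)
  · rw [← integral_influence_mul_influence hV hY]
    exact (hlaw 0).integral_comp ((hmeas j).mul (hmeas k)).aestronglyMeasurable

/-- Asymptotic normality at a solution of the population normal equations. -/
theorem tendstoInDistribution_estimator [IsProbabilityMeasure P] [IsProbabilityMeasure μ]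
    (hlaw : ∀ i, HasLaw (fun ω => (X i ω, Y i ω)) P μ)
    (hindep : iIndepFun (fun i ω => (X i ω, Y i ω)) μ) (hV : 0 < mass P x₀ h)
    (hY : MemLp (fun p => p.2) 2 (localLaw P x₀ h)) (hinv : IsUnit (sigmaOneX P x₀ h))
    {β : EuclideanSpace ℝ (Fin (d + 1))}
    (hβ : ∀ j, ∫ p, residual β p * withOne p.1 j ∂(localLaw P x₀ h) = 0) :
    TendstoInDistribution
      (fun (n : ℕ) ω => √(n : ℝ) •
        (estimator x₀ h (fun i : Fin n => X i ω) (fun i : Fin n => Y i ω) - β))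
      atTop id (fun _ => μ) (multivariateGaussian 0 (sandwich P x₀ h β)) := by
  set A := mass P x₀ h • sigmaOneX P x₀ h with hA
  have hAunit : IsUnit A := by
    rw [Matrix.isUnit_iff_isUnit_det, hA, Matrix.det_smul]
    exact ((isUnit_iff_ne_zero.2 hV.ne').pow _).mul ((Matrix.isUnit_iff_isUnit_det _).1 hinv)
  set G : ℕ → Ω → Matrix (Fin (d + 1)) (Fin (d + 1)) ℝ :=
    fun n ω => ∑ i ∈ Finset.range n, gramTerm x₀ h (X i ω, Y i ω) with hG
  set M : ℕ → Ω → Fin (d + 1) → Fin (d + 1) → ℝ :=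
    fun n ω j k => (((n : ℝ)⁻¹ • G n ω)⁻¹ * A) j k with hM
  have hMmeas : ∀ n, AEMeasurable (M n) μ := fun n => by
    refine aemeasurable_pi_lambda _ fun j => aemeasurable_pi_lambda _ fun k => ?_
    simp only [hM, Matrix.mul_apply]
    refine Finset.aemeasurable_fun_sum _ fun l _ => AEMeasurable.mul_const ?_ _
    refine aemeasurable_inv_apply (fun j k => ?_) j l
    exact (aemeasurable_sum_gramTerm hlaw x₀ h n j k).const_mul _
  have hgram := ae_tendsto_gram hlaw hindep hV
  have hMlim : TendstoInMeasure μ M atTop fun _ j k => (1 : Matrix _ _ ℝ) j k := by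
    refine tendstoInMeasure_of_tendsto_ae (fun n => (hMmeas n).aestronglyMeasurable) ?_
    filter_upwards [hgram] with ω hω
    -- Inversion is continuous at the invertible limit `A`, so `(n⁻¹ G_n)⁻¹ A` tends to `A⁻¹ A = 1`.
    have hlim := (((continuousAt_inv_of_isUnit hAunit).tendsto.comp hω).mul_const A)
    rw [Matrix.nonsing_inv_mul _ ((Matrix.isUnit_iff_isUnit_det _).1 hAunit)] at hlim
    exact hlim
  have hcont : Continuous fun q : EuclideanSpace ℝ (Fin (d + 1)) × (Fin (d + 1) → Fin (d + 1) → ℝ) =>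
      WithLp.toLp 2 ((Matrix.of q.2).mulVec q.1.ofLp) := by
    refine (PiLp.continuous_toLp 2 _).comp (continuous_pi fun j => ?_)
    simp only [Matrix.mulVec, dotProduct, Matrix.of_apply]
    fun_prop
  have hslutsky := (tendstoInDistribution_influence hlaw hindep hV hY hβ
    ).continuous_comp_prodMk_of_tendstoInMeasure_const hcont hMlim hMmeas
  have hone : (fun ω : EuclideanSpace ℝ (Fin (d + 1)) => WithLp.toLp 2
      ((Matrix.of fun j k => (1 : Matrix (Fin (d + 1)) (Fin (d + 1)) ℝ) j k).mulVec ω.ofLp)) = id := by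
    ext ω j
    exact congrFun (Matrix.one_mulVec ω.ofLp) j
  simp only [id, hone] at hslutsky
  have hmeas : ∀ n : ℕ, AEMeasurable (fun ω => √(n : ℝ) •
      (estimator x₀ h (fun i : Fin n => X i ω) (fun i : Fin n => Y i ω) - β)) μ := fun n =>
    ((aemeasurable_estimator hlaw x₀ h n).sub_const β).fun_const_smul (√(n : ℝ))
  -- The Slutsky sequence equals the scaled error only where the Gram matrix is invertible. Almost
  -- surely this holds for all large `n`, so the difference is eventually zero and the limits agree.
  refine tendstoInDistribution_of_tendstoInMeasure_sub _ _ hslutsky ?_ hmeas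
  refine tendstoInMeasure_of_tendsto_ae
    (fun n => ((hmeas n).sub (hslutsky.forall_aemeasurable n)).aestronglyMeasurable) ?_
  filter_upwards [hgram] with ω hω
  have hdet : ∀ᶠ n : ℕ in atTop, ((n : ℝ)⁻¹ • G n ω).det ≠ 0 :=
    ((continuous_id.matrix_det.tendsto A).comp hω).eventually_ne
      ((Matrix.isUnit_iff_isUnit_det A).1 hAunit).ne_zero
  refine tendsto_const_nhds.congr' ?_
  filter_upwards [hdet, eventually_gt_atTop 0] with n hn hn0
  have hn0' : (0 : ℝ) < n := by exact_mod_cast hn0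
  have hGdet : (G n ω).det ≠ 0 := fun h0 => hn (by rw [Matrix.det_smul, h0, mul_zero])
  have hGunit : IsUnit (G n ω) := (Matrix.isUnit_iff_isUnit_det _).2 hGdet.isUnit
  have hscale : ((n : ℝ)⁻¹ • G n ω)⁻¹ = (n : ℝ) • (G n ω)⁻¹ := by
    refine Matrix.inv_eq_left_inv ?_
    rw [Matrix.smul_mul, Matrix.mul_smul, smul_smul, mul_inv_cancel₀ hn0'.ne', one_smul,
      Matrix.nonsing_inv_mul _ hGdet.isUnit]
  have hMn : Matrix.of (M n ω) = (n : ℝ) • ((G n ω)⁻¹ * A) := by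
    ext j k
    simp only [hM, Matrix.of_apply, hscale, Matrix.smul_mul]
  simp only [Pi.zero_apply, Pi.sub_apply]
  rw [eq_comm, sub_eq_zero, estimator_sub_eq hV hinv β (X · ω) (Y · ω) hGunit, hMn]
  refine WithLp.ofLp_injective 2 ?_
  simp only [WithLp.ofLp_smul, Matrix.mulVec_smul, Matrix.smul_mulVec, smul_smul]
  -- Only the scalar identity `√n = n / √n` remains.
  congr 1
  field_simp
  exact Real.sq_sqrt hn0'.le

end Sample

end LocalLinear

theorem mainTheorem6 {d : ℕ} {Ω : Type*} [MeasurableSpace Ω]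
    (μ : Measure Ω) [IsProbabilityMeasure μ]
    (P : Measure ((Fin d → ℝ) × ℝ)) [IsProbabilityMeasure P]
    (X : ℕ → Ω → Fin d → ℝ) (Y : ℕ → Ω → ℝ)
    (hlaw : ∀ i, HasLaw (fun ω => (X i ω, Y i ω)) P μ)
    (hindep : iIndepFun (fun i ω => (X i ω, Y i ω)) μ)
    (x₀ h : Fin d → ℝ)
    (hV : 0 < LocalLinear.mass P x₀ h)
    (hvar_pos : 0 < evariance Prod.snd (LocalLinear.localLaw P x₀ h))
    (hvar_fin : evariance Prod.snd (LocalLinear.localLaw P x₀ h) < ⊤)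
    (hinv : IsUnit (LocalLinear.sigmaOneX P x₀ h)) :
    (∃! β, LocalLinear.IsBestLocalFit P x₀ h β) ∧
    ∀ β, LocalLinear.IsBestLocalFit P x₀ h β →
      (∀ j k, Integrable (fun p => LocalLinear.residual β p ^ 2 *
        LocalLinear.withOne p.1 j * LocalLinear.withOne p.1 k)
          (LocalLinear.localLaw P x₀ h)) ∧
      (LocalLinear.sandwich P x₀ h β).PosSemidef ∧
      TendstoInDistribution
        (fun (n : ℕ) ω => √(n : ℝ) •
          (LocalLinear.estimator x₀ h (fun i : Fin n => X i ω) (fun i : Fin n => Y i ω) - β))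
        atTop id (fun _ => μ)
        (multivariateGaussian 0 (LocalLinear.sandwich P x₀ h β)) := by
  have hY := LocalLinear.memLp_snd hV hvar_fin
  obtain ⟨β₀, hβ₀⟩ := LocalLinear.exists_normal_equations hV hY hinv
  have hbest := LocalLinear.isBestLocalFit_iff_eq hV hY hinv hβ₀
  refine ⟨⟨β₀, (hbest β₀).2 rfl, fun b hb => (hbest b).1 hb⟩, fun β hβ => ?_⟩
  obtain rfl := (hbest β).1 hβ
  exact ⟨LocalLinear.integrable_residual_sq_mul hV hY β, LocalLinear.posSemidef_sandwich hV hY β,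
    LocalLinear.tendstoInDistribution_estimator hlaw hindep hV hY hinv hβ₀⟩
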